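/- For a graph $H$ and a graph $G$ let $\mathcal{N}(H,G)$ denote the number of (not necessarily induced) subgraphs of $G$ that are isomorphic to $H$, and let $\mathrm{ex}(n,H,F)$ denote the maximum of $\mathcal{N}(H,G)$ over all simple graphs $G$ on $n$ vertices that contain no subgraph isomorphic to $F$. Let $P_4$ be the path on four vertices, $K_4$ the complete graph on four vertices, and $T(n,3)$ the $n$-vertex Turán graph, i.e. the complete $3$-partite graph on $n$ vertices whose (possibly empty) classes have sizes as equal as possible. Then for every $n\ge 0$ the graph $T(n,3)$ is $K_4$-free and $$\mathrm{ex}(n,P_4,K_4)=\mathcal{N}(P_4,T(n,3)).$$ That is, $T(n,3)$ maximizes the number of copies of $P_4$ among all $n$-vertex $K_4$-free graphs. -/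

import Mathlib

open scoped Classical in
/-- The generalized extremal number `ex(n, H, F)`: the maximum number of (not necessarily induced,
unlabelled) copies of `H` in an `F`-free simple graph on `n` vertices. A graph is `F`-free when it
has no (not necessarily induced) subgraph isomorphic to `F`. As for Mathlib's
`SimpleGraph.extremalNumber`, the value is `0` if there is no `F`-free graph on `n` vertices. -/
noncomputable def SimpleGraph.genExtremalNumber (n : ℕ) {V W : Type*}
    (H : SimpleGraph V) (F : SimpleGraph W) : ℕ :=
  Finset.sup {G : SimpleGraph (Fin n) | F.Free G} (fun G => G.copyCount H)

/-! Labelled copies are `|Aut P₄|` times unlabelled ones, so it suffices to maximize labelled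
copies. These number `∑ (d(y) - 1)(d(z) - 1)` over ordered middle edges, minus the ordered triangles
(`labelledCopyCount_pathGraph_four`).

The main step is Zykov symmetrization. For nonadjacent `u`, `v`, making either one a twin of the
other preserves `K₄`-freeness, and on average the two replacements lose no paths if the
neighbourhoods meet or are nested (`two_mul_splitPathSum_le`). In the remaining case they are
disjoint and nonempty, and adding the edge `uv` keeps the graph `K₄`-free and creates a new path. So
take a maximizer that also has the most twin pairs: its nonadjacent vertices are twins, hence it is
complete multipartite, with at most three classes.

What is left is a polynomial in three class sizes, which does not decrease when a vertex moves from
a largest to a smallest class that is smaller by at least two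
(`tripartitePathCount_le_of_add_two_le`). -/

namespace SimpleGraph

variable {V W : Type*}

/-! ### Labelled and unlabelled copies -/

theorem toSubgraph_coeCopy_comp {G : SimpleGraph V} {H : SimpleGraph W} (G' : G.Subgraph)
    (e : H ≃g G'.coe) : (G'.coeCopy.comp e.toCopy).toSubgraph = G' := by
  have : (G'.coeCopy.comp e.toCopy).toHom = G'.hom.comp e.toHom := rfl
  rw [Copy.toSubgraph, this]
  simp [Subgraph.map_comp]

theorem labelledCopyCount_eq_natCard [Fintype V] [Fintype W] (G : SimpleGraph V)
    (H : SimpleGraph W) : G.labelledCopyCount H = Nat.card (Copy H G) := by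
  classical rw [labelledCopyCount, Nat.card_eq_fintype_card]

/-- Each unlabelled copy of `H` carries as many labellings as `H` has automorphisms. -/
theorem labelledCopyCount_eq_card_aut_mul_copyCount [Fintype V] [Fintype W]
    (G : SimpleGraph V) (H : SimpleGraph W) :
    G.labelledCopyCount H = Nat.card (H ≃g H) * G.copyCount H := by
  classical
  -- A labelled copy is its image subgraph together with an isomorphism onto it.
  let F : (Σ G' : {G' : G.Subgraph // Nonempty (H ≃g G'.coe)}, H ≃g G'.1.coe) → Copy H G :=
    fun p => p.1.1.coeCopy.comp p.2.toCopy
  have hF : Function.Bijective F := by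
    constructor
    · rintro ⟨⟨G₁, h₁⟩, e₁⟩ ⟨⟨G₂, h₂⟩, e₂⟩ h
      have hG : G₁ = G₂ := by
        rw [← toSubgraph_coeCopy_comp G₁ e₁, ← toSubgraph_coeCopy_comp G₂ e₂]
        exact congrArg _ h
      subst hG
      have : e₁ = e₂ := by
        ext x
        exact DFunLike.congr_fun h x
      rw [this]
    · intro f
      refine ⟨⟨⟨f.toSubgraph, ⟨f.isoToSubgraph⟩⟩, f.isoToSubgraph⟩, ?_⟩
      ext x
      rfl
  have h1 : ∀ G' : {G' : G.Subgraph // Nonempty (H ≃g G'.coe)},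
      Nat.card (H ≃g G'.1.coe) = Nat.card (H ≃g H) := fun ⟨G', ⟨e⟩⟩ =>
    Nat.card_congr
      { toFun := fun f => f.trans e.symm
        invFun := fun f => f.trans e
        left_inv := fun f => by ext; simp
        right_inv := fun f => by ext; simp }
  have h3 : G.copyCount H = Nat.card {G' : G.Subgraph // Nonempty (H ≃g G'.coe)} := by
    rw [copyCount, Nat.card_eq_fintype_card, Fintype.card_subtype]
  have (G' : G.Subgraph) : Finite (H ≃g G'.coe) := DFunLike.finite _
  rw [labelledCopyCount_eq_natCard, ← Nat.card_eq_of_bijective F hF, Nat.card_sigma, h3]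
  simp [h1, mul_comm, Nat.card_eq_fintype_card]

theorem labelledCopyCount_mono [Fintype V] [Fintype W] {G G' : SimpleGraph V} (H : SimpleGraph W)
    (h : G ≤ G') : G.labelledCopyCount H ≤ G'.labelledCopyCount H := by
  classical
  refine Fintype.card_le_of_injective (fun f : Copy H G => (Copy.ofLE G G' h).comp f) ?_
  intro f g hfg
  ext x
  exact DFunLike.congr_fun hfg x

theorem labelledCopyCount_lt [Fintype V] [Fintype W] {G G' : SimpleGraph V} {H : SimpleGraph W}
    (h : G ≤ G') (f : Copy H G') {x y : W} (hxy : H.Adj x y) (hf : ¬ G.Adj (f x) (f y)) :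
    G.labelledCopyCount H < G'.labelledCopyCount H := by
  classical
  refine Fintype.card_lt_of_injective_not_surjective
    (fun f : Copy H G => (Copy.ofLE G G' h).comp f) ?_ ?_
  · intro f g hfg
    ext x
    exact DFunLike.congr_fun hfg x
  · intro hs
    obtain ⟨g, rfl⟩ := hs f
    exact hf (g.toHom.map_adj hxy)

/-! ### A degree formula for labelled four-vertex paths -/

/-- The copy of the path on four vertices with given successive vertices. -/
def pathGraphFourCopy (G : SimpleGraph V) (f : Fin 4 → V) (hf : Function.Injective f)
    (h01 : G.Adj (f 0) (f 1)) (h12 : G.Adj (f 1) (f 2)) (h23 : G.Adj (f 2) (f 3)) :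
    Copy (pathGraph 4) G where
  toHom :=
    { toFun := f
      map_rel' := by
        intro a b hab
        rw [pathGraph_adj] at hab
        fin_cases a <;> fin_cases b <;> simp at hab <;>
          first
          | exact h01 | exact h12 | exact h23
          | exact h01.symm | exact h12.symm | exact h23.symm }
  injective' := hf

open scoped Classical in
/-- The adjacency indicator of a graph. -/
noncomputable def adjInd (G : SimpleGraph V) (x y : V) : ℤ := if G.Adj x y then 1 else 0

theorem adjInd_congr {G G' : SimpleGraph V} {x y x' y' : V} (h : G.Adj x y ↔ G'.Adj x' y') :
    G.adjInd x y = G'.adjInd x' y' := by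
  classical exact if_congr h rfl rfl

theorem adjInd_comm (G : SimpleGraph V) (x y : V) : G.adjInd x y = G.adjInd y x :=
  adjInd_congr (G.adj_comm x y)

theorem adjInd_self (G : SimpleGraph V) (x : V) : G.adjInd x x = 0 := by simp [adjInd]

theorem adjInd_of_adj {G : SimpleGraph V} {x y : V} (h : G.Adj x y) : G.adjInd x y = 1 := by
  simp [adjInd, h]

theorem adjInd_of_not_adj {G : SimpleGraph V} {x y : V} (h : ¬ G.Adj x y) : G.adjInd x y = 0 := by
  simp [adjInd, h]

/-- For the adjacency indicator `w` of a graph: the number of quadruples forming a path. -/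
def pathSum [Fintype V] (w : V → V → ℤ) : ℤ :=
  ∑ y, ∑ z, w y z * (((∑ x, w y x) - 1) * ((∑ x, w z x) - 1)) -
    ∑ x, ∑ y, ∑ z, w x y * w y z * w z x

/-- A copy of the path on four vertices is a quadruple of vertices. The middle vertices come first. -/
def pathGraphFourCopyEquiv (G : SimpleGraph V) :
    Copy (pathGraph 4) G ≃ {p : V × V × V × V // G.Adj p.1 p.2.1 ∧
      (G.Adj p.1 p.2.2.1 ∧ p.2.1 ≠ p.2.2.1) ∧
        (G.Adj p.2.1 p.2.2.2 ∧ p.1 ≠ p.2.2.2) ∧ p.2.2.1 ≠ p.2.2.2} where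
  toFun := fun f => ⟨(f 1, f 2, f 0, f 3),
    f.toHom.map_adj (by simp [pathGraph_adj]),
    ⟨f.toHom.map_adj (by simp [pathGraph_adj]), f.injective.ne (by decide)⟩,
    ⟨f.toHom.map_adj (by simp [pathGraph_adj]), f.injective.ne (by decide)⟩,
    f.injective.ne (by decide)⟩
  invFun := fun p => pathGraphFourCopy G ![p.1.2.2.1, p.1.1, p.1.2.1, p.1.2.2.2]
    (by
      obtain ⟨⟨y, z, x, t⟩, h1, ⟨h2, h2'⟩, ⟨h3, h3'⟩, h4⟩ := p
      have h5 := h1.ne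
      have h6 := h2.ne
      have h7 := h3.ne
      dsimp only at *
      intro i j hij
      fin_cases i <;> fin_cases j <;> simp at hij ⊢ <;> grind)
    p.2.2.1.1.symm p.2.1 p.2.2.2.1.1
  left_inv := fun f => by
    ext i
    fin_cases i <;> rfl
  right_inv := fun p => rfl

open scoped Classical in
theorem labelledCopyCount_pathGraph_four_eq_card [Fintype V] (G : SimpleGraph V) :
    G.labelledCopyCount (pathGraph 4) = Finset.card {p : V × V × V × V | G.Adj p.1 p.2.1 ∧
      (G.Adj p.1 p.2.2.1 ∧ p.2.1 ≠ p.2.2.1) ∧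
        (G.Adj p.2.1 p.2.2.2 ∧ p.1 ≠ p.2.2.2) ∧ p.2.2.1 ≠ p.2.2.2} := by
  rw [labelledCopyCount_eq_natCard, Nat.card_congr (pathGraphFourCopyEquiv G)]
  exact Nat.subtype_card _ fun x => Finset.mem_filter_univ x

theorem labelledCopyCount_pathGraph_four [Fintype V] (G : SimpleGraph V) :
    (G.labelledCopyCount (pathGraph 4) : ℤ) = pathSum G.adjInd := by
  classical
  have h1 : (G.labelledCopyCount (pathGraph 4) : ℤ) = ∑ y, ∑ z, ∑ x, ∑ t,
      if G.Adj y z ∧ (G.Adj y x ∧ z ≠ x) ∧ (G.Adj z t ∧ y ≠ t) ∧ x ≠ t then (1 : ℤ) else 0 := by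
    rw [labelledCopyCount_pathGraph_four_eq_card, Finset.card_filter]
    push_cast
    simp only [Fintype.sum_prod_type]
  have h2 : ∀ y z, (∑ x, ∑ t,
      if G.Adj y z ∧ (G.Adj y x ∧ z ≠ x) ∧ (G.Adj z t ∧ y ≠ t) ∧ x ≠ t then (1 : ℤ) else 0) =
      G.adjInd y z * (((∑ x, G.adjInd y x) - 1) * ((∑ x, G.adjInd z x) - 1)) -
        ∑ x, G.adjInd y z * G.adjInd z x * G.adjInd x y := by
    intro y z
    by_cases hyz : G.Adj y z
    -- The factors choose the ends `x ≠ z` and `t ≠ y` independently; the pairs with `x = t` close a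
    -- triangle and are removed.
    · have key : ∀ x t,
          (if G.Adj y z ∧ (G.Adj y x ∧ z ≠ x) ∧ (G.Adj z t ∧ y ≠ t) ∧ x ≠ t then (1 : ℤ) else 0) =
          (G.adjInd y x - if z = x then 1 else 0) * (G.adjInd z t - if y = t then 1 else 0) -
            if x = t then G.adjInd z x * G.adjInd x y else 0 := by
        intro x t
        have := hyz.symm
        unfold adjInd
        by_cases a : z = x
        · subst a
          by_cases b : y = t
          · subst b; simp [hyz, hyz.ne']
          · by_cases c : z = t <;> simp [hyz, b, c]
        · by_cases b : y = t
          · subst b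
            by_cases c : x = y <;> simp [a, c, this]
          · by_cases c : x = t
            · subst c
              by_cases d : G.Adj y x <;> by_cases e : G.Adj z x <;>
                simp [a, b, d, e, G.adj_comm x y]
            · by_cases d : G.Adj y x <;> by_cases e : G.Adj z t <;> simp [*]
      simp only [key, Finset.sum_sub_distrib, adjInd_of_adj hyz, one_mul]
      simp only [← Finset.mul_sum, ← Finset.sum_mul, Finset.sum_sub_distrib]
      simp
    · simp [hyz, adjInd_of_not_adj hyz]
  rw [h1, pathSum]
  simp only [h2, Finset.sum_sub_distrib]

/-! ### Twin replacement at two nonadjacent vertices -/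

/-- `pathSum` of a graph with two distinguished nonadjacent vertices, in terms of the adjacency
indicator `m` on the set `S` of remaining vertices and the neighbourhoods `a`, `b` of the two. -/
def splitPathSum (S : Finset V) (m : V → V → ℤ) (a b : V → ℤ) : ℤ :=
  ∑ x ∈ S, ∑ y ∈ S, m x y * ((∑ z ∈ S, m x z) - 1 + a x + b x) * ((∑ z ∈ S, m y z) - 1 + a y + b y)
    + 2 * ((∑ x ∈ S, a x) - 1) * ∑ x ∈ S, a x * ((∑ z ∈ S, m x z) - 1 + a x + b x)
    + 2 * ((∑ x ∈ S, b x) - 1) * ∑ x ∈ S, b x * ((∑ z ∈ S, m x z) - 1 + a x + b x)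
    - ∑ x ∈ S, ∑ y ∈ S, ∑ z ∈ S, m x y * m y z * m z x
    - 3 * ∑ x ∈ S, ∑ y ∈ S, m x y * (a x * a y)
    - 3 * ∑ x ∈ S, ∑ y ∈ S, m x y * (b x * b y)

theorem splitPathSum_congr {S : Finset V} {m m' : V → V → ℤ} {a a' b b' : V → ℤ}
    (hm : ∀ x ∈ S, ∀ y ∈ S, m x y = m' x y) (ha : ∀ x ∈ S, a x = a' x) (hb : ∀ x ∈ S, b x = b' x) :
    splitPathSum S m a b = splitPathSum S m' a' b' := by
  have hd : ∀ x ∈ S, ∑ z ∈ S, m x z = ∑ z ∈ S, m' x z := fun x hx =>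
    Finset.sum_congr rfl fun y hy => hm x hx y hy
  have e1 : ∑ x ∈ S, a x = ∑ x ∈ S, a' x := Finset.sum_congr rfl ha
  have e2 : ∑ x ∈ S, b x = ∑ x ∈ S, b' x := Finset.sum_congr rfl hb
  unfold splitPathSum
  rw [e1, e2]
  congr 1; congr 1; congr 1; congr 1; congr 1
  · exact Finset.sum_congr rfl fun x hx => Finset.sum_congr rfl fun y hy => by
      rw [hm x hx y hy, hd x hx, hd y hy, ha x hx, hb x hx, ha y hy, hb y hy]
  · congr 1
    exact Finset.sum_congr rfl fun x hx => by rw [hd x hx, ha x hx, hb x hx]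
  · congr 1
    exact Finset.sum_congr rfl fun x hx => by rw [hd x hx, ha x hx, hb x hx]
  · exact Finset.sum_congr rfl fun x hx => Finset.sum_congr rfl fun y hy =>
      Finset.sum_congr rfl fun z hz => by rw [hm x hx y hy, hm y hy z hz, hm z hz x hx]
  · congr 1
    exact Finset.sum_congr rfl fun x hx => Finset.sum_congr rfl fun y hy => by
      rw [hm x hx y hy, ha x hx, ha y hy]
  · congr 1
    exact Finset.sum_congr rfl fun x hx => Finset.sum_congr rfl fun y hy => by
      rw [hm x hx y hy, hb x hx, hb y hy]

/-- Separate the terms that involve `u` or `v`. The factors 2 are the two orientations of a middle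
edge at `u` or `v`, the factors 3 the positions of that vertex in an ordered triangle. -/
theorem pathSum_eq_splitPathSum [Fintype V] [DecidableEq V] {u v : V} (huv : u ≠ v)
    {w : V → V → ℤ} (hsymm : ∀ x y, w x y = w y x) (huu : w u u = 0) (hvv : w v v = 0)
    (hw : w u v = 0) :
    pathSum w = splitPathSum (Finset.univ \ {u, v}) w (w u) (w v) := by
  have hsum : ∀ f : V → ℤ, ∑ x, f x = f u + f v + ∑ x ∈ Finset.univ \ {u, v}, f x := by
    intro f
    rw [← Finset.sum_sdiff (Finset.subset_univ {u, v}), Finset.sum_pair huv, add_comm]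
  set S : Finset V := Finset.univ \ {u, v}
  have hu : ∀ x, w x u = w u x := fun x => hsymm _ _
  have hv : ∀ x, w x v = w v x := fun x => hsymm _ _
  unfold pathSum splitPathSum
  simp only [hsum, huu, hvv, hw, hu, hv, zero_mul, mul_zero, zero_add, add_zero,
    Finset.sum_const_zero, Finset.sum_add_distrib]
  have e1 : ∀ c : V → ℤ, ∑ x ∈ S, ∑ y ∈ S, w x y * c y * c x
      = ∑ x ∈ S, ∑ y ∈ S, w x y * (c x * c y) := fun c =>
    Finset.sum_congr rfl fun x _ => Finset.sum_congr rfl fun y _ => by ring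
  have e2 : ∀ c : V → ℤ, ∑ x ∈ S, ∑ y ∈ S, c x * c y * w y x
      = ∑ x ∈ S, ∑ y ∈ S, w x y * (c x * c y) := fun c =>
    Finset.sum_congr rfl fun x _ => Finset.sum_congr rfl fun y _ => by rw [hsymm y x]; ring
  have e3 : ∀ c : V → ℤ, ∑ x ∈ S, ∑ y ∈ S, c x * w x y * c y
      = ∑ x ∈ S, ∑ y ∈ S, w x y * (c x * c y) := fun c =>
    Finset.sum_congr rfl fun x _ => Finset.sum_congr rfl fun y _ => by ring
  have e4 : ∀ c : V → ℤ,
      ∑ x ∈ S, c x * ((∑ x ∈ S, c x - 1) * (w u x + w v x + ∑ z ∈ S, w x z - 1)) =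
      (∑ x ∈ S, c x - 1) * ∑ x ∈ S, c x * (∑ z ∈ S, w x z - 1 + w u x + w v x) := fun c => by
    rw [Finset.mul_sum]
    exact Finset.sum_congr rfl fun x _ => by ring
  have e5 : ∀ c : V → ℤ,
      ∑ x ∈ S, c x * ((w u x + w v x + ∑ z ∈ S, w x z - 1) * (∑ x ∈ S, c x - 1)) =
      (∑ x ∈ S, c x - 1) * ∑ x ∈ S, c x * (∑ z ∈ S, w x z - 1 + w u x + w v x) := fun c => by
    rw [Finset.mul_sum]
    exact Finset.sum_congr rfl fun x _ => by ring
  have e6 : ∑ x ∈ S, ∑ y ∈ S,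
      w x y * ((w u x + w v x + ∑ z ∈ S, w x z - 1) * (w u y + w v y + ∑ z ∈ S, w y z - 1)) =
      ∑ x ∈ S, ∑ y ∈ S,
        w x y * (∑ z ∈ S, w x z - 1 + w u x + w v x) * (∑ z ∈ S, w y z - 1 + w u y + w v y) :=
    Finset.sum_congr rfl fun x _ => Finset.sum_congr rfl fun y _ => by ring
  rw [e1 (w u), e1 (w v), e2 (w u), e2 (w v), e3 (w u), e3 (w v), e4 (w u), e4 (w v), e5 (w u),
    e5 (w v), e6]
  ring

/-- The effect on `splitPathSum` of replacing either distinguished vertex by a twin of the other. -/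
theorem splitPathSum_add_splitPathSum_sub (S : Finset V) (m : V → V → ℤ)
    (a b : V → ℤ) :
    splitPathSum S m a a + splitPathSum S m b b - 2 * splitPathSum S m a b =
      2 * ∑ x ∈ S, ∑ y ∈ S, m x y * ((a x - b x) * (a y - b y))
      + 4 * ((∑ x ∈ S, a x) - 1) * ∑ x ∈ S, a x * (a x - b x)
      + 4 * ((∑ x ∈ S, b x) - 1) * ∑ x ∈ S, b x * (b x - a x) := by
  unfold splitPathSum
  set d : V → ℤ := fun x => (∑ z ∈ S, m x z) - 1
  have hd : ∀ x, (∑ z ∈ S, m x z) - 1 = d x := fun x => rfl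
  simp only [hd]
  have h1 : ∑ x ∈ S, ∑ y ∈ S, m x y * (d x + a x + a x) * (d y + a y + a y)
      + ∑ x ∈ S, ∑ y ∈ S, m x y * (d x + b x + b x) * (d y + b y + b y)
      - 2 * ∑ x ∈ S, ∑ y ∈ S, m x y * (d x + a x + b x) * (d y + a y + b y)
      = 2 * ∑ x ∈ S, ∑ y ∈ S, m x y * ((a x - b x) * (a y - b y)) := by
    simp only [Finset.mul_sum, ← Finset.sum_add_distrib, ← Finset.sum_sub_distrib]
    exact Finset.sum_congr rfl fun x _ => Finset.sum_congr rfl fun y _ => by ring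
  have h2 : ∀ a b : V → ℤ, ∑ x ∈ S, a x * (d x + a x + a x) - ∑ x ∈ S, a x * (d x + a x + b x)
      = ∑ x ∈ S, a x * (a x - b x) := by
    intro a b
    rw [← Finset.sum_sub_distrib]
    exact Finset.sum_congr rfl fun x _ => by ring
  have h3 : ∑ x ∈ S, b x * (d x + a x + b x) = ∑ x ∈ S, b x * (d x + b x + a x) :=
    Finset.sum_congr rfl fun x _ => by ring
  have h4 := h2 a b
  have h5 := h2 b a
  rw [h3]
  linear_combination h1 + 4 * ((∑ x ∈ S, a x) - 1) * h4 + 4 * ((∑ x ∈ S, b x) - 1) * h5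

/-- With `p = |A \ B|`, `q = |B \ A|`, `c = |A ∩ B|`, the gain is at least `4((c + p - 1)p + (c + q
- 1)q - pq)`. This is nonnegative if `c ≥ 1` or `pq = 0`, but can fail otherwise, for example when
`c = 0` and `p = q = 1`. -/
theorem two_mul_splitPathSum_le {S : Finset V} {m : V → V → ℤ}
    (hm0 : ∀ x y, 0 ≤ m x y) (hm1 : ∀ x y, m x y ≤ 1) {a b : V → ℤ}
    (ha : ∀ x, a x = 0 ∨ a x = 1) (hb : ∀ x, b x = 0 ∨ b x = 1)
    (h : (∃ x ∈ S, a x = 1 ∧ b x = 1) ∨ (∀ x ∈ S, a x ≤ b x) ∨ ∀ x ∈ S, b x ≤ a x) :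
    2 * splitPathSum S m a b ≤ splitPathSum S m a a + splitPathSum S m b b := by
  have key := splitPathSum_add_splitPathSum_sub S m a b
  have p0 : ∀ x, 0 ≤ a x * (1 - b x) := fun x => by
    rcases ha x with h | h <;> rcases hb x with h' | h' <;> simp [h, h']
  have q0 : ∀ x, 0 ≤ b x * (1 - a x) := fun x => by
    rcases ha x with h | h <;> rcases hb x with h' | h' <;> simp [h, h']
  have c0 : ∀ x, 0 ≤ a x * b x := fun x => by
    rcases ha x with h | h <;> rcases hb x with h' | h' <;> simp [h, h']
  -- Only pairs with one vertex in `A \ B` and the other in `B \ A` contribute negatively, each at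
  -- least `-1`.
  have hQ : -(2 * ((∑ x ∈ S, a x * (1 - b x)) * ∑ x ∈ S, b x * (1 - a x))) ≤
      ∑ x ∈ S, ∑ y ∈ S, m x y * ((a x - b x) * (a y - b y)) := by
    have e : -(2 * ((∑ x ∈ S, a x * (1 - b x)) * ∑ x ∈ S, b x * (1 - a x))) =
        ∑ x ∈ S, ∑ y ∈ S, -(a x * (1 - b x) * (b y * (1 - a y)) +
          b x * (1 - a x) * (a y * (1 - b y))) := by
      simp only [Finset.sum_neg_distrib, Finset.sum_add_distrib, ← Finset.mul_sum,
        ← Finset.sum_mul]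
      ring
    rw [e]
    refine Finset.sum_le_sum fun x _ => Finset.sum_le_sum fun y _ => ?_
    have i0 := hm0 x y
    have i1 := hm1 x y
    rcases ha x with h1 | h1 <;> rcases hb x with h2 | h2 <;> rcases ha y with h3 | h3 <;>
      rcases hb y with h4 | h4 <;> simp [h1, h2, h3, h4, i0, i1]
  have ea : ∑ x ∈ S, a x = ∑ x ∈ S, a x * b x + ∑ x ∈ S, a x * (1 - b x) := by
    rw [← Finset.sum_add_distrib]
    exact Finset.sum_congr rfl fun x _ => by ring
  have eb : ∑ x ∈ S, b x = ∑ x ∈ S, a x * b x + ∑ x ∈ S, b x * (1 - a x) := by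
    rw [← Finset.sum_add_distrib]
    exact Finset.sum_congr rfl fun x _ => by ring
  have ep : ∑ x ∈ S, a x * (a x - b x) = ∑ x ∈ S, a x * (1 - b x) :=
    Finset.sum_congr rfl fun x _ => by rcases ha x with h | h <;> simp [h]
  have eq : ∑ x ∈ S, b x * (b x - a x) = ∑ x ∈ S, b x * (1 - a x) :=
    Finset.sum_congr rfl fun x _ => by rcases hb x with h | h <;> simp [h]
  have hp := Finset.sum_nonneg fun x (_ : x ∈ S) => p0 x
  have hq := Finset.sum_nonneg fun x (_ : x ∈ S) => q0 x
  have hc := Finset.sum_nonneg fun x (_ : x ∈ S) => c0 x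
  rw [ep, eq, ea, eb] at key
  have hcase : 1 ≤ ∑ x ∈ S, a x * b x ∨ ∑ x ∈ S, a x * (1 - b x) = 0 ∨
      ∑ x ∈ S, b x * (1 - a x) = 0 := by
    rcases h with ⟨x, hx, hax, hbx⟩ | h | h
    · left
      refine le_trans ?_ (Finset.single_le_sum (fun y _ => c0 y) hx)
      simp [hax, hbx]
    · right; left
      refine Finset.sum_eq_zero fun x hx => ?_
      have := h x hx
      rcases ha x with h1 | h1 <;> rcases hb x with h2 | h2 <;> simp_all
    · right; right
      refine Finset.sum_eq_zero fun x hx => ?_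
      have := h x hx
      rcases ha x with h1 | h1 <;> rcases hb x with h2 | h2 <;> simp_all
  generalize ∑ x ∈ S, a x * (1 - b x) = p at *
  generalize ∑ x ∈ S, b x * (1 - a x) = q at *
  generalize ∑ x ∈ S, a x * b x = c at *
  have sq_le : ∀ t : ℤ, 0 ≤ t → t ≤ t * t := fun t ht => by
    rcases ht.eq_or_lt with h | h
    · simp [← h]
    · nlinarith
  have := sq_le p hp
  have := sq_le q hq
  rcases hcase with h | h | h
  · nlinarith [mul_nonneg (sub_nonneg.2 h) hp, mul_nonneg (sub_nonneg.2 h) hq, sq_nonneg (p - q),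
      mul_nonneg hp hq]
  · subst h; nlinarith [mul_nonneg hc hq]
  · subst h; nlinarith [mul_nonneg hc hp]

/-- Zykov symmetrization does not decrease the number of four-vertex paths on average. -/
theorem two_mul_labelledCopyCount_le_replaceVertex [Fintype V] [DecidableEq V] (G : SimpleGraph V)
    {u v : V} (huv : u ≠ v) (hn : ¬ G.Adj u v)
    (h : (∃ x, G.Adj u x ∧ G.Adj v x) ∨ (∀ x, G.Adj u x → G.Adj v x) ∨
      ∀ x, G.Adj v x → G.Adj u x) :
    2 * G.labelledCopyCount (pathGraph 4) ≤
      (G.replaceVertex u v).labelledCopyCount (pathGraph 4) +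
        (G.replaceVertex v u).labelledCopyCount (pathGraph 4) := by
  have hn' : ¬ G.Adj v u := fun h => hn h.symm
  have hS : ∀ x ∈ (Finset.univ \ {u, v} : Finset V), x ≠ u ∧ x ≠ v := by simp
  have split : ∀ G' : SimpleGraph V, ¬ G'.Adj u v →
      (G'.labelledCopyCount (pathGraph 4) : ℤ) =
        splitPathSum (Finset.univ \ {u, v}) G'.adjInd (G'.adjInd u) (G'.adjInd v) := by
    intro G' h'
    rw [labelledCopyCount_pathGraph_four, pathSum_eq_splitPathSum huv G'.adjInd_comm
      (G'.adjInd_self u) (G'.adjInd_self v) (adjInd_of_not_adj h')]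
  have h0 := split G hn
  have h1 : ((G.replaceVertex u v).labelledCopyCount (pathGraph 4) : ℤ) =
      splitPathSum (Finset.univ \ {u, v}) G.adjInd (G.adjInd u) (G.adjInd u) := by
    rw [split _ (G.not_adj_replaceVertex_same u v)]
    refine splitPathSum_congr (fun x hx y hy => ?_) (fun x hx => ?_) (fun x hx => ?_)
    · exact adjInd_congr (G.adj_replaceVertex_iff_of_ne u (hS x hx).2 (hS y hy).2)
    · exact adjInd_congr (G.adj_replaceVertex_iff_of_ne_left u (hS x hx).2)
    · exact adjInd_congr (G.adj_replaceVertex_iff_of_ne_right u (hS x hx).2)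
  have h2 : ((G.replaceVertex v u).labelledCopyCount (pathGraph 4) : ℤ) =
      splitPathSum (Finset.univ \ {u, v}) G.adjInd (G.adjInd v) (G.adjInd v) := by
    rw [split _ (fun h => G.not_adj_replaceVertex_same v u h.symm)]
    refine splitPathSum_congr (fun x hx y hy => ?_) (fun x hx => ?_) (fun x hx => ?_)
    · exact adjInd_congr (G.adj_replaceVertex_iff_of_ne v (hS x hx).1 (hS y hy).1)
    · exact adjInd_congr (G.adj_replaceVertex_iff_of_ne_right v (hS x hx).1)
    · exact adjInd_congr (G.adj_replaceVertex_iff_of_ne_left v (hS x hx).1)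
  have h01 : ∀ x y, G.adjInd x y = 0 ∨ G.adjInd x y = 1 := fun x y => by
    unfold adjInd; split_ifs <;> simp
  have hle : ∀ {s t : V}, (∀ x, G.Adj s x → G.Adj t x) → ∀ x, G.adjInd s x ≤ G.adjInd t x := by
    intro s t hst x
    by_cases hs : G.Adj s x
    · rw [adjInd_of_adj hs, adjInd_of_adj (hst x hs)]
    · rw [adjInd_of_not_adj hs]
      rcases h01 t x with h | h <;> simp [h]
  have key := two_mul_splitPathSum_le (S := Finset.univ \ {u, v}) (m := G.adjInd)
    (a := G.adjInd u) (b := G.adjInd v)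
    (fun x y => by rcases h01 x y with h | h <;> simp [h])
    (fun x y => by rcases h01 x y with h | h <;> simp [h]) (h01 u) (h01 v) (by
      rcases h with ⟨x, hux, hvx⟩ | h | h
      · exact .inl ⟨x, by simp [hux.ne', hvx.ne'], adjInd_of_adj hux, adjInd_of_adj hvx⟩
      · exact .inr (.inl fun x _ => hle h x)
      · exact .inr (.inr fun x _ => hle h x))
  zify
  rw [h0, h1, h2]
  exact key

/-! ### Disjoint neighbourhoods: adding an edge -/

/-- A clique using the new edge has a third vertex, which would be a common neighbour of `u` and
`v`. -/
theorem CliqueFree.sup_edge_of_forall_not_adj {G : SimpleGraph V} {n : ℕ}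
    (hG : G.CliqueFree (n + 3)) {u v : V} (h : ∀ x, G.Adj u x → ¬ G.Adj v x) :
    (G ⊔ edge u v).CliqueFree (n + 3) := by
  classical
  intro s hs
  have hadj : ∀ x y, (G ⊔ edge u v).Adj x y → ¬ (x = u ∧ y = v ∨ x = v ∧ y = u) → G.Adj x y := by
    intro x y hxy hne
    rw [sup_adj, edge_adj] at hxy
    tauto
  by_cases huv : u ∈ s ∧ v ∈ s
  · obtain ⟨x, hx, hxu, hxv⟩ : ∃ x ∈ s, x ≠ u ∧ x ≠ v := by
      by_contra! hcon
      have : s ⊆ {u, v} := fun x hx => by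
        by_cases hxu : x = u
        · simp [hxu]
        · simp [hcon x hx hxu]
      have := Finset.card_le_card this
      have := hs.card_eq
      have := Finset.card_le_two (a := u) (b := v)
      omega
    exact h x (hadj u x (hs.isClique huv.1 hx hxu.symm) (by tauto))
      (hadj v x (hs.isClique huv.2 hx hxv.symm) (by tauto))
  · refine hG s ⟨fun x hx y hy hxy => hadj x y (hs.isClique hx hy hxy) ?_, hs.card_eq⟩
    rintro (⟨rfl, rfl⟩ | ⟨rfl, rfl⟩)
    · exact huv ⟨hx, hy⟩
    · exact huv ⟨hy, hx⟩

/-- The path `x u v y` is new; disjointness of the neighbourhoods gives `x ≠ y`. -/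
theorem labelledCopyCount_lt_sup_edge [Fintype V] (G : SimpleGraph V) {u v x y : V}
    (huv : u ≠ v) (hn : ¬ G.Adj u v) (h : ∀ x, G.Adj u x → ¬ G.Adj v x) (hx : G.Adj u x)
    (hy : G.Adj v y) :
    G.labelledCopyCount (pathGraph 4) < (G ⊔ edge u v).labelledCopyCount (pathGraph 4) := by
  have h1 : x ≠ y := fun e => h x hx (e ▸ hy)
  have h2 : x ≠ v := fun e => hn (e ▸ hx)
  have h3 : u ≠ y := fun e => hn (e ▸ hy.symm)
  have h4 := hx.ne
  have h5 := hy.ne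
  refine labelledCopyCount_lt le_sup_left (pathGraphFourCopy (G ⊔ edge u v) ![x, u, v, y] ?_
    (.inl hx.symm) (.inr ?_) (.inl hy)) (x := 1) (y := 2) (by simp [pathGraph_adj]) hn
  · intro i j hij
    fin_cases i <;> fin_cases j <;> simp at hij ⊢ <;> grind
  · simp [edge_adj, huv]

/-! ### Twin classes and a complete multipartite maximizer -/

open scoped Classical in
/-- The number of ordered pairs of vertices with the same neighbourhood. -/
noncomputable def twinCount [Fintype V] (G : SimpleGraph V) : ℕ :=
  Finset.card {p : V × V | G.Adj p.1 = G.Adj p.2}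

-- Moving `u` out of its twin class into one at least as large gains twin pairs. This is the
-- tie-breaker that makes symmetrization terminate.
open scoped Classical in
theorem twinCount_lt_replaceVertex [Fintype V] (G : SimpleGraph V) {u v : V}
    (hne : G.Adj u ≠ G.Adj v)
    (hc : Finset.card {x | G.Adj x = G.Adj u} ≤ Finset.card {x | G.Adj x = G.Adj v}) :
    G.twinCount < (G.replaceVertex v u).twinCount := by
  set U : Finset V := {x | G.Adj x = G.Adj u}
  set W : Finset V := {x | G.Adj x = G.Adj v}
  set A : Finset (V × V) := {p | G.Adj p.1 = G.Adj p.2 ∧ p.1 ≠ u ∧ p.2 ≠ u}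
  have hW : ∀ x ∈ W, x ≠ u := by
    rintro x hx rfl
    exact hne (by simpa [W] using hx)
  have h1 : G.twinCount ≤ A.card + (U.card + U.card) := by
    have hsub : ({p : V × V | G.Adj p.1 = G.Adj p.2} : Finset (V × V)) ⊆
        A ∪ ({u} ×ˢ U ∪ U ×ˢ {u}) := by
      rintro ⟨x, y⟩ hp
      simp only [Finset.mem_filter_univ] at hp
      by_cases hx : x = u
      · subst hx; simp [U, hp]
      · by_cases hy : y = u
        · subst hy; simp [U, hp]
        · simp [A, hp, hx, hy]
    refine (Finset.card_le_card hsub).trans ((Finset.card_union_le _ _).trans ?_)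
    gcongr
    refine (Finset.card_union_le _ _).trans ?_
    simp
  -- Twin pairs avoiding `u` survive. The `+ 1` is the pair `(u, u)`, which the upper bound `h1`
  -- counts twice inside `U.card + U.card`; it makes the inequality strict even for classes of equal
  -- size.
  have h2 : A.card + (W.card + W.card + 1) ≤ (G.replaceVertex v u).twinCount := by
    have d1 : Disjoint (({u} : Finset V) ×ˢ W) (W ×ˢ {u}) := by
      rw [Finset.disjoint_left]
      rintro ⟨x, y⟩ h h'
      simp only [Finset.mem_product, Finset.mem_singleton] at h h'
      exact hW x h'.1 h.1
    have d2 : Disjoint (({u} : Finset V) ×ˢ W ∪ W ×ˢ {u}) {(u, u)} := by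
      rw [Finset.disjoint_singleton_right]
      simp only [Finset.mem_union, Finset.mem_product, not_or, not_and]
      exact ⟨fun _ h => hW u h rfl, fun h => (hW u h rfl).elim⟩
    have d3 : Disjoint A (({u} : Finset V) ×ˢ W ∪ W ×ˢ {u} ∪ {(u, u)}) := by
      rw [Finset.disjoint_left]
      rintro ⟨x, y⟩ h
      simp only [A, Finset.mem_filter_univ] at h
      simp [h.2.1, h.2.2, Ne.symm h.2.1, Ne.symm h.2.2]
    have hcard : A.card + (W.card + W.card + 1) =
        (A ∪ (({u} : Finset V) ×ˢ W ∪ W ×ˢ {u} ∪ {(u, u)})).card := by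
      rw [Finset.card_union_of_disjoint d3, Finset.card_union_of_disjoint d2,
        Finset.card_union_of_disjoint d1]
      simp
    rw [hcard]
    refine Finset.card_le_card ?_
    have huW : ∀ x ∈ W, (G.replaceVertex v u).Adj u = (G.replaceVertex v u).Adj x := by
      intro x hx
      have hx' : G.Adj x = G.Adj v := by simpa [W] using hx
      have hxv : ¬ G.Adj x v := by rw [hx']; exact G.loopless.irrefl v
      funext z
      by_cases hz : z = u
      · simp [replaceVertex, hz, hW x hx, hxv]
      · simp [replaceVertex, hz, hW x hx, hx']
    rintro ⟨x, y⟩ hp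
    simp only [Finset.mem_union, Finset.mem_product, Finset.mem_singleton, Prod.mk.injEq] at hp
    simp only [Finset.mem_filter_univ]
    rcases hp with hp | (⟨rfl, hy⟩ | ⟨hx, rfl⟩) | ⟨rfl, rfl⟩
    · simp only [A, Finset.mem_filter_univ] at hp
      funext z
      by_cases hz : z = u <;> simp [replaceVertex, hz, hp.1, hp.2.1, hp.2.2]
    · exact huW y hy
    · exact (huW x hx).symm
    · rfl
  omega

/-- Some `K₄`-free complete multipartite graph maximizes the number of four-vertex paths. -/
theorem exists_isCompleteMultipartite_labelledCopyCount_max [Fintype V] :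
    ∃ G : SimpleGraph V, G.CliqueFree 4 ∧ G.IsCompleteMultipartite ∧
      ∀ G' : SimpleGraph V, G'.CliqueFree 4 →
        G'.labelledCopyCount (pathGraph 4) ≤ G.labelledCopyCount (pathGraph 4) := by
  classical
  obtain ⟨G, hG, hmax⟩ := Finset.exists_max_image
    ({G : SimpleGraph V | G.CliqueFree 4} : Finset (SimpleGraph V))
    (fun G => toLex (G.labelledCopyCount (pathGraph 4), G.twinCount))
    ⟨⊥, by simp [cliqueFree_bot]⟩
  simp only [Finset.mem_filter_univ, Prod.Lex.toLex_le_toLex] at hG hmax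
  have hle : ∀ G' : SimpleGraph V, G'.CliqueFree 4 →
      G'.labelledCopyCount (pathGraph 4) ≤ G.labelledCopyCount (pathGraph 4) := by
    intro G' h'
    rcases hmax G' h' with h | h
    · exact h.le
    · exact h.1.le
  have hcase : ∀ u v, u ≠ v → ¬ G.Adj u v → (∃ x, G.Adj u x ∧ G.Adj v x) ∨
      (∀ x, G.Adj u x → G.Adj v x) ∨ ∀ x, G.Adj v x → G.Adj u x := by
    intro u v huv hn
    by_contra! hcon
    obtain ⟨h0, ⟨x, hx, -⟩, y, hy, -⟩ := hcon
    exact absurd (hle _ (CliqueFree.sup_edge_of_forall_not_adj hG h0))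
      (labelledCopyCount_lt_sup_edge G huv hn h0 hx hy).not_ge
  have htwin : ∀ u v, ¬ G.Adj u v → G.Adj u = G.Adj v := by
    have main : ∀ u v, ¬ G.Adj u v → G.Adj u ≠ G.Adj v →
        ¬ Finset.card {x | G.Adj x = G.Adj u} ≤ Finset.card {x | G.Adj x = G.Adj v} := by
      intro u v hn hne hc
      have huv : u ≠ v := fun h => hne (h ▸ rfl)
      -- Neither replacement exceeds the maximum and their average reaches it, so both attain it;
      -- then the larger twin count contradicts the choice of `G`.
      have h1 := two_mul_labelledCopyCount_le_replaceVertex G huv hn (hcase u v huv hn)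
      have h2 := hle _ (hG.replaceVertex u v)
      have h3 := twinCount_lt_replaceVertex G hne hc
      rcases hmax _ (hG.replaceVertex v u) with h | h <;> omega
    intro u v hn
    by_contra hne
    rcases le_total (Finset.card {x | G.Adj x = G.Adj u})
      (Finset.card {x | G.Adj x = G.Adj v}) with h | h
    · exact main u v hn hne h
    · exact main v u (fun h => hn h.symm) (fun h => hne h.symm) h
  refine ⟨G, hG, ⟨fun x y z hxy hyz => ?_⟩, hle⟩
  rwa [htwin x y hxy]

/-! ### Optimizing the class sizes -/

/-- The number of labelled four-vertex paths in the complete tripartite graph with classes of sizes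
`a`, `b`, `c`. -/
def tripartitePathCount (a b c : ℤ) : ℤ :=
  2 * ((a * b + b * c + a * c) ^ 2 - (a + b + c - 1) * (a * b + b * c + a * c) +
    (a + b + c - 6) * (a * b * c))

theorem labelledCopyCount_comap_top [Fintype V] (χ : V → Fin 3) :
    (((⊤ : SimpleGraph (Fin 3)).comap χ).labelledCopyCount (pathGraph 4) : ℤ) =
      tripartitePathCount (Finset.card {x | χ x = 0}) (Finset.card {x | χ x = 1})
        (Finset.card {x | χ x = 2}) := by
  have hsum : ∀ g : Fin 3 → ℤ, ∑ x, g (χ x) = (Finset.card {x | χ x = 0} : ℤ) * g 0 +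
      (Finset.card {x | χ x = 1} : ℤ) * g 1 + (Finset.card {x | χ x = 2} : ℤ) * g 2 := by
    intro g
    rw [← Finset.sum_fiberwise Finset.univ χ (fun x => g (χ x)), Fin.sum_univ_three]
    have : ∀ i : Fin 3, ∑ x with χ x = i, g (χ x) = (Finset.card {x | χ x = i} : ℤ) * g i := by
      intro i
      rw [Finset.sum_congr rfl (g := fun _ => g i) fun x hx => by
        rw [(Finset.mem_filter_univ x).1 hx]]
      simp
    rw [this, this, this]
  generalize (Finset.card {x | χ x = 0} : ℤ) = a at *
  generalize (Finset.card {x | χ x = 1} : ℤ) = b at *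
  generalize (Finset.card {x | χ x = 2} : ℤ) = c at *
  have hadj : ∀ x y, ((⊤ : SimpleGraph (Fin 3)).comap χ).adjInd x y =
      (fun i j : Fin 3 => if i = j then (0 : ℤ) else 1) (χ x) (χ y) := by
    intro x y
    by_cases h : χ x = χ y <;> simp [adjInd, h]
  generalize hw : (fun i j : Fin 3 => if i = j then (0 : ℤ) else 1) = w at hadj
  have h2 : ∀ g : Fin 3 → Fin 3 → ℤ, ∑ x, ∑ y, g (χ x) (χ y) =
      a * (a * g 0 0 + b * g 0 1 + c * g 0 2) + b * (a * g 1 0 + b * g 1 1 + c * g 1 2) +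
        c * (a * g 2 0 + b * g 2 1 + c * g 2 2) := by
    intro g
    simp only [fun i => hsum (g i)]
    rw [hsum fun i => a * g i 0 + b * g i 1 + c * g i 2]
  have hdeg : ∀ x, ∑ y, w (χ x) (χ y) = (fun i => a * w i 0 + b * w i 1 + c * w i 2) (χ x) :=
    fun x => hsum (w (χ x))
  have htri : ∀ x y, ∑ z, w (χ x) (χ y) * w (χ y) (χ z) * w (χ z) (χ x) =
      (fun i j => a * (w i j * w j 0 * w 0 i) + b * (w i j * w j 1 * w 1 i) +
        c * (w i j * w j 2 * w 2 i)) (χ x) (χ y) :=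
    fun x y => hsum fun k => w (χ x) (χ y) * w (χ y) k * w k (χ x)
  rw [labelledCopyCount_pathGraph_four, pathSum]
  simp only [hadj, hdeg, htri]
  rw [h2 fun i j => w i j * ((a * w i 0 + b * w i 1 + c * w i 2 - 1) *
      (a * w j 0 + b * w j 1 + c * w j 2 - 1)),
    h2 fun i j => a * (w i j * w j 0 * w 0 i) + b * (w i j * w j 1 * w 1 i) +
      c * (w i j * w j 2 * w 2 i)]
  simp [← hw, tripartitePathCount]
  ring

/-- The difference factors with `a - c - 1 > 0`. The only delicate factor is `3a + 3c + b - 7`,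
which is nonnegative once `b ≥ 1`, since `a ≥ 2`; it vanishes at `(2, 1, 0)`. -/
theorem tripartitePathCount_le_of_add_two_le {a b c : ℤ} (hb : 0 ≤ b) (hc : 0 ≤ c)
    (h : c + 2 ≤ a) :
    tripartitePathCount a b c ≤ tripartitePathCount (a - 1) b (c + 1) := by
  have hdiff : tripartitePathCount (a - 1) b (c + 1) - tripartitePathCount a b c =
      2 * ((a - c - 1) * (2 * (c * (a - 1)) + b * (3 * a + 3 * c + b - 7))) := by
    unfold tripartitePathCount
    ring
  have h1 : 0 ≤ c * (a - 1) := mul_nonneg hc (by linarith)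
  have h2 : 0 ≤ b * (3 * a + 3 * c + b - 7) := by
    rcases hb.eq_or_lt with h | h
    · simp [← h]
    · exact mul_nonneg hb (by linarith)
  have := mul_nonneg (show 0 ≤ a - c - 1 by linarith) (show
    0 ≤ 2 * (c * (a - 1)) + b * (3 * a + 3 * c + b - 7) by linarith)
  linarith

theorem tripartitePathCount_swap_left (a b c : ℤ) :
    tripartitePathCount a b c = tripartitePathCount b a c := by
  unfold tripartitePathCount; ring

theorem tripartitePathCount_swap_right (a b c : ℤ) :
    tripartitePathCount a b c = tripartitePathCount a c b := by
  unfold tripartitePathCount; ring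

/-- Balanced class sizes `k ≥ l ≥ m` are optimal. -/
theorem tripartitePathCount_le_of_sorted {k l m : ℤ} (hkl : l ≤ k) (hlm : m ≤ l) (hkm : k ≤ m + 1)
    (N : ℕ) : ∀ a b c : ℤ, 0 ≤ a → 0 ≤ b → 0 ≤ c → a + b + c = k + l + m →
      a ^ 2 + b ^ 2 + c ^ 2 ≤ N → tripartitePathCount a b c ≤ tripartitePathCount k l m := by
  induction N using Nat.strong_induction_on with
  | _ N ih =>
    have sorted : ∀ a b c : ℤ, 0 ≤ c → c ≤ b → b ≤ a → a + b + c = k + l + m →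
        a ^ 2 + b ^ 2 + c ^ 2 ≤ N → tripartitePathCount a b c ≤ tripartitePathCount k l m := by
      intro a b c hc hcb hba hs hN
      by_cases hac : c + 2 ≤ a
      · refine (tripartitePathCount_le_of_add_two_le (hc.trans hcb) hc hac).trans ?_
        -- The sum of squares drops by `2(a - c - 1) > 0`, so the induction descends.
        have hlt : (a - 1) ^ 2 + b ^ 2 + (c + 1) ^ 2 < (N : ℤ) := by nlinarith
        have h0 : 0 ≤ (a - 1) ^ 2 + b ^ 2 + (c + 1) ^ 2 := by positivity
        lift (a - 1) ^ 2 + b ^ 2 + (c + 1) ^ 2 to ℕ using h0 with M hM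
        exact ih M (by exact_mod_cast hlt) (a - 1) b (c + 1) (by linarith) (by linarith)
          (by linarith) (by linarith) hM.ge
      · obtain ⟨rfl, rfl, rfl⟩ : a = k ∧ b = l ∧ c = m := by omega
        exact le_rfl
    intro a b c ha hb hc hs hN
    rcases le_total a b with h1 | h1 <;> rcases le_total b c with h2 | h2 <;>
      rcases le_total a c with h3 | h3
    · rw [tripartitePathCount_swap_left, tripartitePathCount_swap_right,
        tripartitePathCount_swap_left]
      exact sorted c b a ha h1 h2 (by linarith) (by linarith)
    · rw [tripartitePathCount_swap_left, tripartitePathCount_swap_right,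
        tripartitePathCount_swap_left]
      exact sorted c b a ha h1 h2 (by linarith) (by linarith)
    · rw [tripartitePathCount_swap_left, tripartitePathCount_swap_right]
      exact sorted b c a ha h3 h2 (by linarith) (by linarith)
    · rw [tripartitePathCount_swap_left]
      exact sorted b a c hc h3 h1 (by linarith) (by linarith)
    · rw [tripartitePathCount_swap_right, tripartitePathCount_swap_left]
      exact sorted c a b hb h1 h3 (by linarith) (by linarith)
    · rw [tripartitePathCount_swap_right]
      exact sorted a c b hb h2 h3 (by linarith) (by linarith)
    · exact sorted a b c hc h2 h1 (by linarith) (by linarith)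
    · exact sorted a b c hc h2 h1 (by linarith) (by linarith)

/-! ### Comparison with the Turán graph -/

theorem card_filter_val_mod_eq (n r i : ℕ) (hr : 0 < r) (hi : i < r) :
    Finset.card {x : Fin n | x.1 % r = i} = n / r + if i < n % r then 1 else 0 := by
  have h := Nat.count_modEq_card n hr i
  rw [Nat.mod_eq_of_lt hi, Nat.count_eq_card_filter_range, Finset.card_filter,
    Finset.sum_range] at h
  rw [← h, Finset.card_filter]
  simp only [Nat.ModEq, Nat.mod_eq_of_lt hi]

theorem turanGraph_three_eq_comap (n : ℕ) : turanGraph n 3 =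
    (⊤ : SimpleGraph (Fin 3)).comap fun x : Fin n => ⟨x.1 % 3, Nat.mod_lt _ (by decide)⟩ := by
  ext x y
  simp [turanGraph_adj]

theorem labelledCopyCount_turanGraph_three (n : ℕ) :
    ((turanGraph n 3).labelledCopyCount (pathGraph 4) : ℤ) =
      tripartitePathCount (n / 3 + if 0 < n % 3 then 1 else 0)
        (n / 3 + if 1 < n % 3 then 1 else 0) (n / 3) := by
  rw [turanGraph_three_eq_comap, labelledCopyCount_comap_top]
  have h0 := card_filter_val_mod_eq n 3 0 (by decide) (by decide)
  have h1 := card_filter_val_mod_eq n 3 1 (by decide) (by decide)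
  have h2 := card_filter_val_mod_eq n 3 2 (by decide) (by decide)
  simp only [Fin.ext_iff, Fin.isValue, Fin.val_zero, Fin.val_one, Fin.val_two]
  rw [h0, h1, h2, if_neg (by omega : ¬ 2 < n % 3)]
  push_cast
  congr 1

theorem labelledCopyCount_le_turanGraph_three {n : ℕ} {G : SimpleGraph (Fin n)}
    (hG : G.CliqueFree 4) :
    G.labelledCopyCount (pathGraph 4) ≤ (turanGraph n 3).labelledCopyCount (pathGraph 4) := by
  obtain ⟨M, hM, hmulti, hmax⟩ := exists_isCompleteMultipartite_labelledCopyCount_max (V := Fin n)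
  obtain ⟨χ⟩ : M.Colorable 3 := hmulti.colorable_of_cliqueFree hM
  -- Passing to the full tripartite graph of a colouring allows empty classes and can only add
  -- paths.
  have hle : M ≤ (⊤ : SimpleGraph (Fin 3)).comap χ := fun x y hxy => χ.valid hxy
  refine (hmax G hG).trans ((labelledCopyCount_mono _ hle).trans ?_)
  zify
  rw [labelledCopyCount_comap_top, labelledCopyCount_turanGraph_three]
  have hcard : Finset.card {x | χ x = 0} + Finset.card {x | χ x = 1} +
      Finset.card {x | χ x = 2} = n := by
    have := Finset.card_eq_sum_card_fiberwise (s := Finset.univ) (t := Finset.univ) (f := χ)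
      fun x _ => Finset.mem_coe.2 (Finset.mem_univ (χ x))
    rw [Finset.card_univ, Fintype.card_fin, Fin.sum_univ_three] at this
    exact this.symm
  refine tripartitePathCount_le_of_sorted ?_ ?_ ?_
    (Finset.card {x | χ x = 0} ^ 2 + Finset.card {x | χ x = 1} ^ 2 +
      Finset.card {x | χ x = 2} ^ 2) _ _ _ (by positivity) (by positivity) (by positivity) ?_
    (by push_cast; exact le_rfl)
  all_goals split_ifs <;> omega

end SimpleGraph

/-- Among all `K₄`-free graphs on `n` vertices, the Turán graph `T(n, 3)` (which is itself
`K₄`-free) has the maximum number of copies of the four-vertex path. -/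
theorem mainTheorem3 (n : ℕ) :
    (SimpleGraph.completeGraph (Fin 4)).Free (SimpleGraph.turanGraph n 3) ∧
      SimpleGraph.genExtremalNumber n (SimpleGraph.pathGraph 4)
          (SimpleGraph.completeGraph (Fin 4)) =
        (SimpleGraph.turanGraph n 3).copyCount (SimpleGraph.pathGraph 4) := by
  have hfree : ∀ G : SimpleGraph (Fin n),
      (SimpleGraph.completeGraph (Fin 4)).Free G ↔ G.CliqueFree 4 := fun G => by
    rw [SimpleGraph.Free, ← SimpleGraph.not_cliqueFree_iff_top_isContained, not_not]
  have hT : (SimpleGraph.completeGraph (Fin 4)).Free (SimpleGraph.turanGraph n 3) :=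
    (hfree _).2 (SimpleGraph.turanGraph_cliqueFree (by decide))
  refine ⟨hT, le_antisymm (Finset.sup_le fun G hG => ?_) ?_⟩
  · have hG' := (hfree G).1 (by simpa using hG)
    have h := SimpleGraph.labelledCopyCount_le_turanGraph_three hG'
    rw [SimpleGraph.labelledCopyCount_eq_card_aut_mul_copyCount,
      SimpleGraph.labelledCopyCount_eq_card_aut_mul_copyCount] at h
    have : Finite (SimpleGraph.pathGraph 4 ≃g SimpleGraph.pathGraph 4) := DFunLike.finite _
    have : Nonempty (SimpleGraph.pathGraph 4 ≃g SimpleGraph.pathGraph 4) :=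
      ⟨SimpleGraph.Iso.refl⟩
    exact le_of_mul_le_mul_left h Nat.card_pos
  · exact Finset.le_sup (f := fun G : SimpleGraph (Fin n) => G.copyCount (SimpleGraph.pathGraph 4))
      (by simpa using hT)
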